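/- Let $\Sigma$ be a finite alphabet. A nonempty word $w=w_1\dots w_n\in\Sigma^n$ is represented by the structure $\langle w\rangle=([1,n];(Q_s)_{s\in\Sigma},\min,\max,\mathrm{suc},\mathrm{pred})$, where $Q_s(i)\iff w_i=s$, $\min(i)\iff i=1$, $\max(i)\iff i=n$, $\mathrm{suc}(i)=i+1$ for $i<n$ and $\mathrm{suc}(n)=n$, $\mathrm{pred}(i)=i-1$ for $i>1$ and $\mathrm{pred}(1)=1$. For an integer $k\ge 0$, $x+k$ and $x-k$ denote the terms $\mathrm{suc}^k(x)$ and $\mathrm{pred}^k(x)$. An inclusion Horn formula (a formula of $\mathtt{incl}$-$\mathtt{ESO}$-$\mathtt{HORN}$) is a formula $\Phi=\exists\mathbf{R}\,\forall x\,\forall y\,\psi(x,y)$, where $\mathbf{R}$ is a finite set of binary predicates (the computation predicates) and $\psi$ is a finite conjunction of clauses of the form $x\le y\land\delta_1\land\dots\land\delta_r\to\delta_0$, in which $\delta_0$ is either $R(x,y)$ with $R\in\mathbf{R}$, or $\bot$, and each hypothesis $\delta_i$ is of one of the following forms: 1. an input literal $U(x+a)$, $\lnot U(x+a)$, $U(y+a)$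 or $\lnot U(y+a)$, where $U\in\{(Q_s)_{s\in\Sigma},\min,\max\}$ and $a\in\mathbb{Z}$; 2. $x=y$ or $x<y$; 3. a conjunction $S(x+a,y-b)\land x+a\le y-b$, where $S\in\mathbf{R}$ and $a,b\ge 0$ are integers. Two such formulas are equivalent if they hold in $\langle w\rangle$ for the same nonempty words $w$ over $\Sigma$. **Lemma (normalization of inclusion logic).** Every formula $\Phi\in\mathtt{incl}$-$\mathtt{ESO}$-$\mathtt{HORN}$ is equivalent to a formula $\Phi'\in\mathtt{incl}$-$\mathtt{ESO}$-$\mathtt{HORN}$ that is normalized in the following sense, where $\mathbf{R}$ now denotes the set of computation predicates of $\Phi'$: there is a fixed $R_\bot\in\mathbf{R}$ such that $\Phi'$ has exactly one contradiction clause $$\min(x)\land\max(y)\land R_\bot(x,y)\to\bot,$$ and each other clause of $\Phi'$ is either an input clause $$x=y\land Q_s(x)\to R(x,y)\qquad(s\in\Sigma,\ R\in\mathbf{R}),$$ or a computation clause $$x<y\land\delta_1\land\dots\land\delta_r\to R(x,y)\qquad(r\ge 1,\ R\in\mathbf{R}),$$ where each $\delta_i$ is a computation atom $S(x+1,y)$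 or $S(x,y-1)$ with $S\in\mathbf{R}$. (In these three forms the hypothesis $x\le y$ is redundant and omitted, and so are the conjuncts $x+1\le y$ and $x\le y-1$ that accompany the atoms $S(x+1,y)$ and $S(x,y-1)$, since they follow from $x<y$.) -/

import Mathlib

namespace InclLogic

universe u

/-! ### The structure encoding a nonempty word

A word `w` of length `n` is a list of length `n`; its domain `[1,n]` is `Fin w.length`, the element
`i : Fin w.length` standing for the position `i + 1`. -/

/-- The successor function, with `suc n = n` at the last position. -/
def suc {n : ℕ} (i : Fin n) : Fin n :=
  if h : i.val + 1 < n then ⟨i.val + 1, h⟩ else i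

/-- The predecessor function, with `pred 1 = 1` at the first position. -/
def pred {n : ℕ} (i : Fin n) : Fin n :=
  ⟨i.val - 1, lt_of_le_of_lt (Nat.sub_le _ _) i.isLt⟩

/-- The value of the term `x + a` for an integer `a`: the function `suc` iterated `a` times if
`0 ≤ a`, the function `pred` iterated `-a` times if `a < 0`. -/
def shift {n : ℕ} : ℤ → Fin n → Fin n
  | Int.ofNat k, i => suc^[k] i
  | Int.negSucc k, i => pred^[k + 1] i

/-- The input predicates: `Q_s` for a letter `s`, `min` and `max`. -/
inductive InputPred (A : Type u) : Type u
  | letter (s : A)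
  | min
  | max

/-- Interpretation of the input predicates on a word. -/
def InputPred.Holds {A : Type u} (w : List A) : InputPred A → Fin w.length → Prop
  | .letter s, i => w.get i = s
  | .min, i => i.val = 0
  | .max, i => i.val + 1 = w.length

/-! ### Syntax of inclusion Horn formulas -/

/-- The two first-order variables. -/
inductive Var : Type
  | x
  | y

/-- The hypotheses `δ_i` of inclusion Horn clauses, over the alphabet `A` and the computation
predicates `R_0, …, R_{m-1}`. -/
inductive Hyp (A : Type u) (m : ℕ) : Type u
  /-- the input literal `U(v + a)` -/
  | posInput (U : InputPred A) (v : Var) (a : ℤ)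
  /-- the input literal `¬ U(v + a)` -/
  | negInput (U : InputPred A) (v : Var) (a : ℤ)
  /-- the equality `x = y` -/
  | eq
  /-- the inequality `x < y` -/
  | lt
  /-- the conjunction `S(x + a, y - b) ∧ x + a ≤ y - b` -/
  | comp (S : Fin m) (a b : ℕ)

/-- An inclusion Horn clause `x ≤ y ∧ δ_1 ∧ … ∧ δ_r → δ_0`. The hypothesis `x ≤ y` is implicit; the
conclusion `some R` is the computation atom `R(x, y)` and the conclusion `none` is `⊥`. -/
structure Clause (A : Type u) (m : ℕ) : Type u where
  hyps : List (Hyp A m)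
  concl : Option (Fin m)

/-- An inclusion Horn formula `∃ R_0 … R_{m-1} ∀ x ∀ y ψ(x, y)`, where `ψ` is the conjunction of a
finite list of inclusion Horn clauses. -/
structure Formula (A : Type u) : Type u where
  numPreds : ℕ
  clauses : List (Clause A numPreds)

/-! ### Semantics -/

/-- The value of a variable. -/
def Var.val {n : ℕ} (x y : Fin n) : Var → Fin n
  | .x => x
  | .y => y

/-- Truth of a hypothesis at `(x, y)`. -/
def Hyp.Holds {A : Type u} {m : ℕ} (w : List A)
    (R : Fin m → Fin w.length → Fin w.length → Prop) (x y : Fin w.length) : Hyp A m → Prop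
  | .posInput U v a => U.Holds w (shift a (v.val x y))
  | .negInput U v a => ¬ U.Holds w (shift a (v.val x y))
  | .eq => x = y
  | .lt => x < y
  | .comp S a b =>
      R S (shift (a : ℤ) x) (shift (-(b : ℤ)) y) ∧ shift (a : ℤ) x ≤ shift (-(b : ℤ)) y

/-- Truth of a clause at `(x, y)`. -/
def Clause.Holds {A : Type u} {m : ℕ} (w : List A)
    (R : Fin m → Fin w.length → Fin w.length → Prop) (x y : Fin w.length)
    (C : Clause A m) : Prop :=
  x ≤ y → (∀ δ ∈ C.hyps, δ.Holds w R x y) →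
    match C.concl with
    | some S => R S x y
    | none => False

/-- The structure of the word `w` satisfies the formula `Φ`. -/
def Formula.Models {A : Type u} (w : List A) (Φ : Formula A) : Prop :=
  ∃ R : Fin Φ.numPreds → Fin w.length → Fin w.length → Prop,
    ∀ x y : Fin w.length, ∀ C ∈ Φ.clauses, C.Holds w R x y

/-- Two formulas are equivalent if they hold in the structures of the same nonempty words. -/
def Formula.Equivalent {A : Type u} (Φ Ψ : Formula A) : Prop :=
  ∀ w : List A, w ≠ [] → (Φ.Models w ↔ Ψ.Models w)

/-! ### Normalized formulas

The implicit hypothesis `x ≤ y` is redundant in each of the three forms of clauses below, and in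
computation clauses the conjuncts `x + 1 ≤ y` and `x ≤ y - 1` that accompany `S(x + 1, y)` and
`S(x, y - 1)` follow from `x < y`. -/

/-- Input clause `x = y ∧ Q_s(x) → R(x, y)`. -/
def Clause.IsInput {A : Type u} {m : ℕ} (C : Clause A m) : Prop :=
  ∃ (s : A) (R : Fin m), C = ⟨[.eq, .posInput (.letter s) .x 0], some R⟩

/-- Computation clause `x < y ∧ δ_1 ∧ … ∧ δ_r → R(x, y)` with `r ≥ 1`, each hypothesis `δ_i` being
`S(x + 1, y)` or `S(x, y - 1)`. -/
def Clause.IsComputation {A : Type u} {m : ℕ} (C : Clause A m) : Prop :=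
  ∃ (δs : List (Hyp A m)) (R : Fin m), δs ≠ [] ∧
    (∀ δ ∈ δs, ∃ S : Fin m, δ = .comp S 1 0 ∨ δ = .comp S 0 1) ∧
    C = ⟨.lt :: δs, some R⟩

/-- The contradiction clause `min(x) ∧ max(y) ∧ R(x, y) → ⊥`. -/
def Clause.contradiction {A : Type u} {m : ℕ} (R : Fin m) : Clause A m :=
  ⟨[.posInput .min .x 0, .posInput .max .y 0, .comp R 0 0], none⟩

/-- A formula is normalized if, up to the order of its clauses, it consists of exactly one
contradiction clause, for some computation predicate `Rbot`, and of input and computation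
clauses. -/
def Formula.IsNormalized {A : Type u} (Φ : Formula A) : Prop :=
  ∃ (Rbot : Fin Φ.numPreds) (cs : List (Clause A Φ.numPreds)),
    Φ.clauses.Perm (Clause.contradiction Rbot :: cs) ∧
    ∀ C ∈ cs, C.IsInput ∨ C.IsComputation

end InclLogic

namespace InclLogic

universe u

variable {A : Type u}

/-! ### Trellis automata and normalized formulas -/

/-! A Horn formula holds in `w` iff `⊥` is not derivable from its clauses in the least model. A
derivation at `(x, y)` uses only atoms on subintervals of `[x, y]` and, if `K` bounds all shifts,
only letters at distance at most `K + 1` from the interval (`Der.transfer`). The aim is to compute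
derivability by a trellis automaton, in which the state of `[x, y]` is a function of the states of
`[x + 1, y]` and `[x, y - 1]`; such an automaton is easily turned into a normalized formula
(`exists_normalized_of_trellis`).

Letters outside the interval are unknown to the automaton, so a state guesses them: it records, for
every pair of contexts of length `K + 1`, which atoms are derivable at `(x + a, y - b)` with `a, b ≤
K`. It also records boundary letters and a capped length. There are finitely many states.

The core is `state_determined`. A short interval is spelled out by the recorded letters. On a long
one, a premise at a proper subinterval is answered by one of the two substates, with contexts
completed by the boundary letters, and premises at `(x, y)` itself are handled by induction on the
derivation (`Der.whole`). Since contradictions propagate outwards, the state of the whole word with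
blank contexts decides the truth of the formula. -/

/-- Predicates asserted in state `q`: `some q`, and `none` if `q` is rejecting. -/
def Output {Q : Type u} (rej : Q → Prop) (q : Q) : Option Q → Prop
  | some p => p = q
  | none => rej q

lemma val_suc {n : ℕ} {x y : Fin n} (h : x < y) : (suc x).val = x.val + 1 := by
  have := y.isLt
  rw [Fin.lt_def] at h
  rw [suc, dif_pos (by omega)]

lemma val_pred {n : ℕ} (x : Fin n) : (pred x).val = x.val - 1 := rfl

/-- A trellis automaton with finite state set `Q` is simulated by a normalized formula. -/
theorem exists_normalized_of_trellis [Finite A] {Q : Type u} [Finite Q] (init : A → Q)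
    (f : Q → Q → Q) (rej : Q → Prop) :
    ∃ Φ : Formula A, Φ.IsNormalized ∧
      ∀ (w : List A) (hw : w ≠ []) (st : Fin w.length → Fin w.length → Q),
        (∀ x, st x x = init (w.get x)) →
        (∀ x y, x < y → st x y = f (st (suc x) y) (st x (pred y))) →
        (Φ.Models w ↔ ¬ rej (st ⟨0, List.length_pos_iff.2 hw⟩
          ⟨w.length - 1, Nat.sub_lt (List.length_pos_iff.2 hw) one_pos⟩)) := by
  classical
  obtain ⟨k, ⟨e⟩⟩ := Finite.exists_equiv_fin (Option Q)
  let inp : A × Option Q → Clause A k := fun z =>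
    ⟨[.eq, .posInput (.letter z.1) .x 0], some (e z.2)⟩
  let cmp : (Q × Q) × Option Q → Clause A k := fun z =>
    ⟨[.lt, .comp (e (some z.1.1)) 1 0, .comp (e (some z.1.2)) 0 1], some (e z.2)⟩
  have fin1 : (inp '' {z | Output rej (init z.1) z.2}).Finite := (Set.toFinite _).image _
  have fin2 : (cmp '' {z | Output rej (f z.1.1 z.1.2) z.2}).Finite := (Set.toFinite _).image _
  let cs : List (Clause A k) := fin1.toFinset.toList ++ fin2.toFinset.toList
  have hcs : ∀ C, C ∈ cs ↔ (∃ s R, Output rej (init s) R ∧ inp (s, R) = C) ∨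
      ∃ p q R, Output rej (f p q) R ∧ cmp ((p, q), R) = C := by
    intro C
    simp [cs]
  refine ⟨⟨k, Clause.contradiction (e none) :: cs⟩, ⟨e none, cs, List.Perm.refl _, ?_⟩, ?_⟩
  · intro C hC
    rcases (hcs C).1 hC with ⟨s, R, -, rfl⟩ | ⟨p, q, R, -, rfl⟩
    · exact Or.inl ⟨s, e R, rfl⟩
    · refine Or.inr ⟨[.comp (e (some p)) 1 0, .comp (e (some q)) 0 1], e R, by simp, ?_, rfl⟩
      intro δ hδ
      simp only [List.mem_cons, List.not_mem_nil, or_false] at hδ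
      rcases hδ with rfl | rfl
      · exact ⟨_, Or.inl rfl⟩
      · exact ⟨_, Or.inr rfl⟩
  · intro w hw st h0 h1
    have hpos := List.length_pos_iff.2 hw
    constructor
    · rintro ⟨R, hR⟩ hrej
      -- A model may assert more than the run does, but it must contain the run.
      have key : ∀ (d : ℕ) (x y : Fin w.length), y.val = x.val + d →
          ∀ o, Output rej (st x y) o → R (e o) x y := by
        intro d
        induction d with
        | zero =>
          intro x y hd o ho
          obtain rfl : x = y := Fin.ext (by omega)
          rw [h0] at ho
          refine hR x x (inp (w.get x, o)) (List.mem_cons_of_mem _ ((hcs _).2 ?_)) le_rfl ?_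
          · exact Or.inl ⟨_, _, ho, rfl⟩
          · intro δ hδ
            simp only [inp, List.mem_cons, List.not_mem_nil, or_false] at hδ
            rcases hδ with rfl | rfl
            · rfl
            · rfl
        | succ d ih =>
          intro x y hd o ho
          have hxy : x < y := Fin.lt_def.2 (by omega)
          have hs := val_suc hxy
          have hp := val_pred y
          rw [h1 x y hxy] at ho
          refine hR x y (cmp ((st (suc x) y, st x (pred y)), o))
            (List.mem_cons_of_mem _ ((hcs _).2 ?_)) hxy.le ?_
          · exact Or.inr ⟨_, _, _, ho, rfl⟩
          · intro δ hδ
            simp only [cmp, List.mem_cons, List.not_mem_nil, or_false] at hδ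
            rcases hδ with rfl | rfl | rfl
            · exact hxy
            · exact ⟨ih (suc x) y (by omega) _ rfl, Fin.le_def.2 (by
                change (suc x).val ≤ y.val; omega)⟩
            · exact ⟨ih x (pred y) (by omega) _ rfl, Fin.le_def.2 (by
                change x.val ≤ (pred y).val; omega)⟩
      have hbot := key (w.length - 1) ⟨0, hpos⟩ ⟨w.length - 1, by omega⟩ (by simp) none hrej
      refine hR ⟨0, hpos⟩ ⟨w.length - 1, by omega⟩ (Clause.contradiction (e none))
        List.mem_cons_self (Fin.le_def.2 (by simp)) ?_
      intro δ hδ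
      simp only [Clause.contradiction, List.mem_cons, List.not_mem_nil, or_false] at hδ
      rcases hδ with rfl | rfl | rfl
      · rfl
      · change w.length - 1 + 1 = w.length
        omega
      · exact ⟨hbot, Fin.le_def.2 (by change 0 ≤ _; omega)⟩
    · intro hrej
      -- The run itself is the model.
      refine ⟨fun R x y => Output rej (st x y) (e.symm R), ?_⟩
      intro x y C hC hxy hyp
      rcases List.mem_cons.1 hC with rfl | hC
      · have a1 : x.val = 0 := hyp (.posInput .min .x 0) (by simp [Clause.contradiction])
        have a2 : y.val + 1 = w.length := hyp (.posInput .max .y 0) (by simp [Clause.contradiction])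
        have a3 := (hyp (.comp (e none) 0 0) (by simp [Clause.contradiction])).1
        have ex : x = ⟨0, hpos⟩ := Fin.ext a1
        have ey : y = ⟨w.length - 1, by omega⟩ := Fin.ext (by simp; omega)
        simp only [Equiv.symm_apply_apply] at a3
        change rej (st x y) at a3
        rw [ex, ey] at a3
        exact hrej a3
      · rcases (hcs C).1 hC with ⟨s, R, ho, rfl⟩ | ⟨p, q, R, ho, rfl⟩
        · have a1 : x = y := hyp .eq (by simp [inp])
          subst a1
          have a2 : w.get x = s := hyp (.posInput (.letter s) .x 0) (by simp [inp])
          change Output rej (st x x) (e.symm (e R))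
          rwa [Equiv.symm_apply_apply, h0, a2]
        · have a1 : x < y := hyp .lt (by simp [cmp])
          have a2 := (hyp (.comp (e (some p)) 1 0) (by simp [cmp])).1
          have a3 := (hyp (.comp (e (some q)) 0 1) (by simp [cmp])).1
          simp only [Equiv.symm_apply_apply] at a2 a3
          change p = st (suc x) y at a2
          change q = st x (pred y) at a3
          change Output rej (st x y) (e.symm (e R))
          rwa [Equiv.symm_apply_apply, h1 x y a1, ← a2, ← a3]

/-! ### Words as partial functions on the integers -/

/-- Successor in `g : ℤ → Option A`, fixed where the next cell is blank. -/
def sucZ (g : ℤ → Option A) (x : ℤ) : ℤ := if (g (x + 1)).isSome then x + 1 else x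

/-- Predecessor in `g : ℤ → Option A`, fixed where the previous cell is blank. -/
def predZ (g : ℤ → Option A) (x : ℤ) : ℤ := if (g (x - 1)).isSome then x - 1 else x

/-- Iterated successor or predecessor. -/
def shiftZ (g : ℤ → Option A) : ℤ → ℤ → ℤ
  | Int.ofNat k, x => (sucZ g)^[k] x
  | Int.negSucc k, x => (predZ g)^[k + 1] x

/-- Input predicates on `g : ℤ → Option A`. -/
def InputPred.HoldsZ (g : ℤ → Option A) : InputPred A → ℤ → Prop
  | .letter s, i => g i = some s
  | .min, i => g (i - 1) = none
  | .max, i => g (i + 1) = none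

/-- The value of a variable in `ℤ`. -/
def Var.valZ (x y : ℤ) : Var → ℤ
  | .x => x
  | .y => y

/-- The part of a hypothesis that does not involve computation predicates. -/
def Hyp.GuardZ {m : ℕ} (g : ℤ → Option A) (x y : ℤ) : Hyp A m → Prop
  | .posInput U v a => U.HoldsZ g (shiftZ g a (v.valZ x y))
  | .negInput U v a => ¬ U.HoldsZ g (shiftZ g a (v.valZ x y))
  | .eq => x = y
  | .lt => x < y
  | .comp _ a b => shiftZ g (a : ℤ) x ≤ shiftZ g (-(b : ℤ)) y

/-- Derivability of computation atoms; `none` stands for a contradiction, which is propagated to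
all larger intervals. -/
inductive Der (Φ : Formula A) (g : ℤ → Option A) : Option (Fin Φ.numPreds) → ℤ → ℤ → Prop
  | clause (C : Clause A Φ.numPreds) (hC : C ∈ Φ.clauses) (x y : ℤ) (hxy : x ≤ y)
      (hg : ∀ δ ∈ C.hyps, δ.GuardZ g x y)
      (hc : ∀ S a b, Hyp.comp S a b ∈ C.hyps →
        Der Φ g (some S) (shiftZ g (a : ℤ) x) (shiftZ g (-(b : ℤ)) y)) :
      Der Φ g C.concl x y
  | left (x y : ℤ) (hxy : x < y) (h : Der Φ g none (x + 1) y) : Der Φ g none x y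
  | right (x y : ℤ) (hxy : x < y) (h : Der Φ g none x (y - 1)) : Der Φ g none x y

/-! ### Displacement of iterated shifts -/

lemma Der.le {Φ : Formula A} {g : ℤ → Option A} {c x y} (h : Der Φ g c x y) : x ≤ y := by
  cases h with
  | clause => assumption
  | left => omega
  | right => omega

lemma sucZ_bounds (g : ℤ → Option A) (x : ℤ) : x ≤ sucZ g x ∧ sucZ g x ≤ x + 1 := by
  unfold sucZ; split_ifs <;> omega

lemma predZ_bounds (g : ℤ → Option A) (x : ℤ) : x - 1 ≤ predZ g x ∧ predZ g x ≤ x := by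
  unfold predZ; split_ifs <;> omega

lemma sucZ_iterate_bounds (g : ℤ → Option A) (k : ℕ) (x : ℤ) :
    x ≤ (sucZ g)^[k] x ∧ (sucZ g)^[k] x ≤ x + k := by
  induction k with
  | zero => simp
  | succ k ih =>
    rw [Function.iterate_succ_apply']
    have := sucZ_bounds g ((sucZ g)^[k] x)
    push_cast
    omega

lemma predZ_iterate_bounds (g : ℤ → Option A) (k : ℕ) (x : ℤ) :
    x - k ≤ (predZ g)^[k] x ∧ (predZ g)^[k] x ≤ x := by
  induction k with
  | zero => simp
  | succ k ih =>
    rw [Function.iterate_succ_apply']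
    have := predZ_bounds g ((predZ g)^[k] x)
    push_cast
    omega

lemma shiftZ_natCast (g : ℤ → Option A) (k : ℕ) (x : ℤ) :
    shiftZ g (k : ℤ) x = (sucZ g)^[k] x := rfl

lemma shiftZ_neg_natCast (g : ℤ → Option A) (k : ℕ) (x : ℤ) :
    shiftZ g (-(k : ℤ)) x = (predZ g)^[k] x := by
  cases k <;> rfl

lemma shiftZ_bounds (g : ℤ → Option A) {K : ℕ} {a : ℤ} (ha : a.natAbs ≤ K) (x : ℤ) :
    x - K ≤ shiftZ g a x ∧ shiftZ g a x ≤ x + K := by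
  cases a with
  | ofNat k =>
    have := sucZ_iterate_bounds g k x
    simp only [shiftZ, Int.ofNat_eq_natCast, Int.natAbs_natCast] at *
    omega
  | negSucc k =>
    have := predZ_iterate_bounds g (k + 1) x
    simp only [shiftZ, Int.natAbs_negSucc] at *
    omega

/-! ### Locality of shifts and input predicates -/

/-- `g` near `x` agrees with `g'` near `x + D`, up to distance `K + 1`. -/
def Near (K : ℕ) (D : ℤ) (g g' : ℤ → Option A) (x : ℤ) : Prop :=
  ∀ t, x - K - 1 ≤ t → t ≤ x + K + 1 → g' (t + D) = g t

/-- After fewer than `K` steps the position is within `K - 1` of `x`, and a step inspects one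
neighbouring cell. The extra cell allowed by `Near` serves `min` and `max`, which inspect a
neighbour of the final position. -/
lemma Near.shiftZ {K : ℕ} {D : ℤ} {g g' : ℤ → Option A} {x : ℤ} (h : Near K D g g' x) {a : ℤ}
    (ha : a.natAbs ≤ K) : shiftZ g' a (x + D) = InclLogic.shiftZ g a x + D := by
  have hs : ∀ k : ℕ, k ≤ K → (sucZ g')^[k] (x + D) = (sucZ g)^[k] x + D := by
    intro k
    induction k with
    | zero => simp
    | succ k ih =>
      intro hk
      rw [Function.iterate_succ_apply', Function.iterate_succ_apply', ih (by omega)]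
      have hb := sucZ_iterate_bounds g k x
      have := h ((sucZ g)^[k] x + 1) (by omega) (by omega)
      rw [sucZ, sucZ, add_right_comm, this]
      split_ifs <;> omega
  have hp : ∀ k : ℕ, k ≤ K → (predZ g')^[k] (x + D) = (predZ g)^[k] x + D := by
    intro k
    induction k with
    | zero => simp
    | succ k ih =>
      intro hk
      rw [Function.iterate_succ_apply', Function.iterate_succ_apply', ih (by omega)]
      have hb := predZ_iterate_bounds g k x
      have := h ((predZ g)^[k] x - 1) (by omega) (by omega)
      rw [predZ, predZ, ← sub_add_eq_add_sub, this]
      split_ifs <;> omega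
  cases a with
  | ofNat k => exact hs k (by simpa using ha)
  | negSucc k => exact hp (k + 1) (by simpa using ha)

lemma Near.holdsZ {K : ℕ} {D : ℤ} {g g' : ℤ → Option A} {x : ℤ} (h : Near K D g g' x) {a : ℤ}
    (ha : a.natAbs ≤ K) (U : InputPred A) :
    U.HoldsZ g' (InclLogic.shiftZ g' a (x + D)) ↔ U.HoldsZ g (InclLogic.shiftZ g a x) := by
  have hb := shiftZ_bounds g ha x
  rw [h.shiftZ ha]
  cases U with
  | letter s => simp only [InputPred.HoldsZ]; rw [h _ (by omega) (by omega)]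
  | min =>
    simp only [InputPred.HoldsZ]
    rw [← sub_add_eq_add_sub, h _ (by omega) (by omega)]
  | max =>
    simp only [InputPred.HoldsZ]
    rw [add_right_comm, h _ (by omega) (by omega)]

/-! ### Bounded shifts and locality of derivability -/

/-- All shifts in `δ` are bounded by `K`. -/
def Hyp.Bounded {m : ℕ} (K : ℕ) : Hyp A m → Prop
  | .posInput _ _ a => a.natAbs ≤ K
  | .negInput _ _ a => a.natAbs ≤ K
  | .eq => True
  | .lt => True
  | .comp _ a b => a ≤ K ∧ b ≤ K

/-- All shifts in `Φ` are bounded by `K`. -/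
def Formula.Bounded (Φ : Formula A) (K : ℕ) : Prop :=
  ∀ C ∈ Φ.clauses, ∀ δ ∈ C.hyps, δ.Bounded K

lemma Hyp.exists_bounded {m : ℕ} (δ : Hyp A m) : ∃ K, ∀ L, K ≤ L → δ.Bounded L := by
  cases δ with
  | posInput U v a => exact ⟨a.natAbs, fun _ h => h⟩
  | negInput U v a => exact ⟨a.natAbs, fun _ h => h⟩
  | eq => exact ⟨0, fun _ _ => trivial⟩
  | lt => exact ⟨0, fun _ _ => trivial⟩
  | comp S a b => exact ⟨a + b, fun L h => ⟨by omega, by omega⟩⟩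

lemma exists_uniform_bound {α : Type*} (l : List α) (P : α → ℕ → Prop)
    (h : ∀ a ∈ l, ∃ K, ∀ L, K ≤ L → P a L) : ∃ K, ∀ L, K ≤ L → ∀ a ∈ l, P a L := by
  induction l with
  | nil => exact ⟨0, by simp⟩
  | cons a l ih =>
    obtain ⟨K, hK⟩ := h a List.mem_cons_self
    obtain ⟨K', hK'⟩ := ih fun b hb => h b (List.mem_cons_of_mem _ hb)
    refine ⟨max K K', fun L hL b hb => ?_⟩
    rcases List.mem_cons.1 hb with rfl | hb
    · exact hK L (le_of_max_le_left hL)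
    · exact hK' L (le_of_max_le_right hL) b hb

lemma Formula.exists_bounded (Φ : Formula A) : ∃ K, 1 ≤ K ∧ Φ.Bounded K := by
  obtain ⟨K, hK⟩ := exists_uniform_bound Φ.clauses (fun C L => ∀ δ ∈ C.hyps, δ.Bounded L)
    fun C _ => exists_uniform_bound C.hyps (fun δ L => δ.Bounded L) fun δ _ => δ.exists_bounded
  exact ⟨K + 1, by omega, hK (K + 1) (by omega)⟩

/-- Derivability inside an interval only depends on the word at distance at most `K + 1`. -/
lemma Der.transfer {Φ : Formula A} {K : ℕ} (hK : Φ.Bounded K) {D : ℤ} {g g' : ℤ → Option A}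
    {x₀ y₀ : ℤ} (hn : ∀ t, x₀ - K - 1 ≤ t → t ≤ y₀ + K + 1 → g' (t + D) = g t)
    {c x y} (h : Der Φ g c x y) (hx : x₀ ≤ x) (hy : y ≤ y₀) : Der Φ g' c (x + D) (y + D) := by
  induction h with
  | clause C hC x y hxy hg hc ih =>
    have nx : Near K D g g' x := fun t h1 h2 => hn t (by omega) (by omega)
    have ny : Near K D g g' y := fun t h1 h2 => hn t (by omega) (by omega)
    have nv : ∀ v : Var, Near K D g g' (v.valZ x y) ∧ v.valZ (x + D) (y + D) = v.valZ x y + D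
      | .x => ⟨nx, rfl⟩
      | .y => ⟨ny, rfl⟩
    refine .clause C hC _ _ (by omega) ?_ ?_
    · intro δ hδ
      have hb := hK C hC δ hδ
      have h0 := hg δ hδ
      cases δ with
      | posInput U v a =>
        simp only [Hyp.GuardZ] at h0 ⊢
        rwa [(nv v).2, (nv v).1.holdsZ hb]
      | negInput U v a =>
        simp only [Hyp.GuardZ] at h0 ⊢
        rwa [(nv v).2, (nv v).1.holdsZ hb]
      | eq => simp only [Hyp.GuardZ] at h0 ⊢; omega
      | lt => simp only [Hyp.GuardZ] at h0 ⊢; omega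
      | comp S a b =>
        simp only [Hyp.GuardZ] at h0 ⊢
        rw [nx.shiftZ (by simpa using hb.1), ny.shiftZ (by simpa using hb.2)]
        omega
    · intro S a b hδ
      have hb := hK C hC _ hδ
      rw [nx.shiftZ (by simpa using hb.1), ny.shiftZ (by simpa using hb.2)]
      refine ih S a b hδ ?_ ?_
      -- Premises shift the ends inwards only, so they stay inside `[x₀, y₀]`.
      · rw [shiftZ_natCast]
        have := sucZ_iterate_bounds g a x
        omega
      · rw [shiftZ_neg_natCast]
        have := predZ_iterate_bounds g b y
        omega
  | left x y hxy h ih =>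
    refine .left _ _ (by omega) ?_
    rw [add_right_comm]
    exact ih (by omega) hy
  | right x y hxy h ih =>
    refine .right _ _ (by omega) ?_
    rw [← sub_add_eq_add_sub]
    exact ih hx (by omega)

lemma der_congr {Φ : Formula A} {K : ℕ} (hK : Φ.Bounded K) {D : ℤ} {g g' : ℤ → Option A}
    {x₀ y₀ : ℤ} (hn : ∀ t, x₀ - K - 1 ≤ t → t ≤ y₀ + K + 1 → g' (t + D) = g t)
    {c x y} (hx : x₀ ≤ x) (hy : y ≤ y₀) : Der Φ g c x y ↔ Der Φ g' c (x + D) (y + D) := by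
  refine ⟨fun h => h.transfer hK hn hx hy, fun h => ?_⟩
  have := h.transfer (D := -D) (g' := g) (x₀ := x₀ + D) (y₀ := y₀ + D) hK (fun t h1 h2 => by
    rw [← hn (t + -D) (by omega) (by omega)]
    congr 1
    omega) (by omega) (by omega)
  simpa using this

/-! ### Finite states of intervals -/

/-- The restriction of `g` to `[x, y]`, extended by finite contexts on both sides. -/
def extend {L : ℕ} (l r : Fin L → Option A) (g : ℤ → Option A) (x y : ℤ) (t : ℤ) : Option A :=
  if t < x then if h : (x - 1 - t).toNat < L then l ⟨_, h⟩ else none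
  else if y < t then if h : (t - y - 1).toNat < L then r ⟨_, h⟩ else none
  else g t

/-- The left context of length `L` of position `x`. -/
def leftContext (L : ℕ) (g : ℤ → Option A) (x : ℤ) (t : Fin L) : Option A := g (x - 1 - t.val)

/-- The right context of length `L` of position `y`. -/
def rightContext (L : ℕ) (g : ℤ → Option A) (y : ℤ) (t : Fin L) : Option A := g (y + 1 + t.val)

/-- Finite information about the word on an interval. -/
abbrev State (A : Type u) (m K : ℕ) : Type u :=
  (Fin (2 * K + 3) × (Fin (2 * K + 2) → Option A) × (Fin (2 * K + 2) → Option A)) ×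
  ((Fin (K + 1) → Option A) → (Fin (K + 1) → Option A) →
    Fin (K + 1) → Fin (K + 1) → Option (Fin m) → Prop)

instance [Finite A] (m K : ℕ) : Finite (State A m K) := by
  have h : Finite ((Fin (K + 1) → Option A) → Fin (K + 1) → Fin (K + 1) → Option (Fin m) → Prop) :=
    inferInstance
  have : Finite ((Fin (K + 1) → Option A) → (Fin (K + 1) → Option A) →
      Fin (K + 1) → Fin (K + 1) → Option (Fin m) → Prop) := @Pi.finite _ _ _ fun _ => h
  exact Finite.instProd

/-- The state of `g` on `[x, y]`: the capped length, the first and last letters, and, for all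
contexts, the atoms derivable near the full interval. -/
def state (Φ : Formula A) (K : ℕ) (g : ℤ → Option A) (x y : ℤ) : State A Φ.numPreds K :=
  ((⟨min (y - x).toNat (2 * K + 2), by omega⟩,
    fun t => if x + t.val ≤ y then g (x + t.val) else none,
    fun t => if x ≤ y - t.val then g (y - t.val) else none),
   fun l r a b c => Der Φ (extend l r g x y) c (x + a.val) (y - b.val))

lemma extend_left {L : ℕ} (l r : Fin L → Option A) (g : ℤ → Option A) (x y : ℤ) (t : Fin L) :
    extend l r g x y (x - 1 - t.val) = l t := by
  have h : (x - 1 - (x - 1 - (t.val : ℤ))).toNat = t.val := by omega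
  rw [extend, if_pos (by omega), dif_pos (by omega)]
  congr 1
  exact Fin.ext h

lemma extend_right {L : ℕ} (l r : Fin L → Option A) (g : ℤ → Option A) {x y : ℤ} (hxy : x ≤ y)
    (t : Fin L) : extend l r g x y (y + 1 + t.val) = r t := by
  have h : (y + 1 + (t.val : ℤ) - y - 1).toNat = t.val := by omega
  rw [extend, if_neg (by omega), if_pos (by omega), dif_pos (by omega)]
  congr 1
  exact Fin.ext h

lemma extend_mid {L : ℕ} (l r : Fin L → Option A) (g : ℤ → Option A) {x y t : ℤ} (h1 : x ≤ t)
    (h2 : t ≤ y) : extend l r g x y t = g t := by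
  rw [extend, if_neg (by omega), if_neg (by omega)]

lemma extend_translate {L : ℕ} (l r : Fin L → Option A) {g g' : ℤ → Option A} {x y D : ℤ}
    (h : ∀ t, x ≤ t → t ≤ y → g' (t + D) = g t) (t : ℤ) :
    extend l r g' (x + D) (y + D) (t + D) = extend l r g x y t := by
  unfold extend
  have e1 : x + D - 1 - (t + D) = x - 1 - t := by omega
  have e2 : t + D - (y + D) - 1 = t - y - 1 := by omega
  simp only [add_lt_add_iff_right, e1, e2]
  split_ifs with h1 h2 h3 h4 <;> first | rfl | exact h t (by omega) (by omega)

/-- Contexts are quantified over inside the state, so no letter outside the interval matters. -/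
lemma state_congr {Φ : Formula A} {K : ℕ} (hK : Φ.Bounded K) {D : ℤ} {g g' : ℤ → Option A}
    {x y : ℤ} (h : ∀ t, x ≤ t → t ≤ y → g' (t + D) = g t) :
    state Φ K g' (x + D) (y + D) = state Φ K g x y := by
  refine Prod.ext (Prod.ext ?_ (Prod.ext ?_ ?_)) ?_
  · simp [state]
  · funext t
    simp only [state]
    rw [add_right_comm]
    simp only [add_le_add_iff_right]
    split_ifs with h1
    · exact h _ (by omega) h1
    · rfl
  · funext t
    simp only [state]
    rw [← sub_add_eq_add_sub]
    simp only [add_le_add_iff_right]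
    split_ifs with h1
    · exact h _ h1 (by omega)
    · rfl
  · funext l r a b c
    simp only [state]
    rw [add_right_comm, ← sub_add_eq_add_sub]
    exact propext (der_congr hK (x₀ := x) (y₀ := y)
      (fun t _ _ => extend_translate l r h t) (by omega) (by omega)).symm

/-- The state and the contexts determine derivability. -/
lemma der_iff_state {Φ : Formula A} {K : ℕ} (hK : Φ.Bounded K) (g : ℤ → Option A) {x y : ℤ}
    (hxy : x ≤ y) (a b : Fin (K + 1)) (c) :
    Der Φ g c (x + a.val) (y - b.val) ↔
      (state Φ K g x y).2 (leftContext _ g x) (rightContext _ g y) a b c := by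
  have key : ∀ t, x - K - 1 ≤ t → t ≤ y + K + 1 →
      extend (leftContext (K + 1) g x) (rightContext (K + 1) g y) g x y (t + 0) = g t := by
    intro t h1 h2
    rw [add_zero]
    rcases lt_or_ge t x with h | h
    · have := extend_left (leftContext (K + 1) g x) (rightContext (K + 1) g y) g x y
        ⟨(x - 1 - t).toNat, by omega⟩
      simp only [leftContext] at this
      rwa [show x - 1 - ((x - 1 - t).toNat : ℤ) = t by omega] at this
    · rcases lt_or_ge y t with h' | h'
      · have := extend_right (leftContext (K + 1) g x) (rightContext (K + 1) g y) g hxy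
          ⟨(t - y - 1).toNat, by omega⟩
        simp only [rightContext] at this
        rwa [show y + 1 + ((t - y - 1).toNat : ℤ) = t by omega] at this
      · exact extend_mid _ _ _ h h'
  have := der_congr hK key (c := c) (x := x + a.val) (y := y - b.val) (by omega) (by omega)
  rwa [add_zero, add_zero] at this

/-! ### States of long intervals -/

/-- One direction of the determination of the state of a long interval. -/
lemma Der.whole {Φ : Formula A} {K : ℕ} (hK1 : 1 ≤ K) (hK : Φ.Bounded K) {g g' : ℤ → Option A}
    {x y x' y' : ℤ} (hl : 2 * K ≤ y - x) (hl' : 2 * K ≤ y' - x') (nx : Near K (x' - x) g g' x)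
    (ny : Near K (y' - y) g g' y)
    (hsub : ∀ a b : ℕ, a ≤ K → b ≤ K → a ≠ 0 ∨ b ≠ 0 → ∀ c,
      Der Φ g c (x + a) (y - b) → Der Φ g' c (x' + a) (y' - b))
    {c} (h : Der Φ g c x y) : Der Φ g' c x' y' := by
  have ex : x + (x' - x) = x' := by omega
  have ey : y + (y' - y) = y' := by omega
  -- Clauses may use atoms at `(x, y)` itself, which `hsub` does not cover; these cycles call for
  -- induction on the derivation, with the indices generalized.
  suffices H : ∀ c p q, Der Φ g c p q → p = x → q = y → Der Φ g' c x' y' from H c x y h rfl rfl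
  clear h
  intro c p q h
  induction h with
  | clause C hC p q hpq hg hc ih =>
    rintro rfl rfl
    have nv : ∀ v : Var, ∃ D, Near K D g g' (v.valZ p q) ∧ v.valZ x' y' = v.valZ p q + D
      | .x => ⟨_, nx, ex.symm⟩
      | .y => ⟨_, ny, ey.symm⟩
    have sx : ∀ a : ℕ, a ≤ K → shiftZ g' (a : ℤ) x' = shiftZ g (a : ℤ) p + (x' - p) ∧
        p ≤ shiftZ g (a : ℤ) p ∧ shiftZ g (a : ℤ) p ≤ p + K := by
      intro a ha
      have h1 := nx.shiftZ (a := (a : ℤ)) (by simpa using ha)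
      rw [ex] at h1
      have h2 := sucZ_iterate_bounds g a p
      rw [← shiftZ_natCast] at h2
      exact ⟨h1, h2.1, by omega⟩
    have sy : ∀ b : ℕ, b ≤ K → shiftZ g' (-(b : ℤ)) y' = shiftZ g (-(b : ℤ)) q + (y' - q) ∧
        q - K ≤ shiftZ g (-(b : ℤ)) q ∧ shiftZ g (-(b : ℤ)) q ≤ q := by
      intro b hb
      have h1 := ny.shiftZ (a := -(b : ℤ)) (by simpa using hb)
      rw [ey] at h1
      have h2 := predZ_iterate_bounds g b q
      rw [← shiftZ_neg_natCast] at h2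
      exact ⟨h1, by omega, h2.2⟩
    refine .clause C hC _ _ (by omega) ?_ ?_
    · intro δ hδ
      have hb := hK C hC δ hδ
      have h0 := hg δ hδ
      cases δ with
      | posInput U v a =>
        obtain ⟨D, hD, hv⟩ := nv v
        simp only [Hyp.GuardZ] at h0 ⊢
        rwa [hv, hD.holdsZ hb]
      | negInput U v a =>
        obtain ⟨D, hD, hv⟩ := nv v
        simp only [Hyp.GuardZ] at h0 ⊢
        rwa [hv, hD.holdsZ hb]
      -- The two ends are translated by different amounts, but `y - x ≥ 2 * K ≥ 2` in both
      -- intervals: `eq` is false, `lt` is true, and inward shifts by at most `K` cannot cross.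
      | eq => simp only [Hyp.GuardZ] at h0 ⊢; omega
      | lt => simp only [Hyp.GuardZ] at h0 ⊢; omega
      | comp S a b =>
        simp only [Hyp.GuardZ] at h0 ⊢
        have := sx a hb.1
        have := sy b hb.2
        omega
    · intro S a b hδ
      have hb := hK C hC _ hδ
      have h1 := sx a hb.1
      have h2 := sy b hb.2
      -- The actual displacements `i`, `j` may be smaller than `a`, `b`, because shifts stop at
      -- blanks.
      obtain ⟨i, hi⟩ := Int.eq_ofNat_of_zero_le (sub_nonneg.2 h1.2.1)
      obtain ⟨j, hj⟩ := Int.eq_ofNat_of_zero_le (sub_nonneg.2 h2.2.2)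
      have e1 : shiftZ g' (a : ℤ) x' = x' + i := by omega
      have e2 : shiftZ g' (-(b : ℤ)) y' = y' - j := by omega
      by_cases hij : i ≠ 0 ∨ j ≠ 0
      · rw [e1, e2]
        refine hsub i j (by omega) (by omega) hij _ ?_
        have := hc S a b hδ
        rwa [show shiftZ g (a : ℤ) p = p + i by omega,
          show shiftZ g (-(b : ℤ)) q = q - j by omega] at this
      · rw [show shiftZ g' (a : ℤ) x' = x' by omega, show shiftZ g' (-(b : ℤ)) y' = y' by omega]
        exact ih S a b hδ (by omega) (by omega)
  | left p q hpq h _ =>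
    rintro rfl rfl
    refine .left _ _ (by omega) ?_
    have := hsub 1 0 hK1 (by omega) (by simp) none (by simpa using h)
    simpa using this
  | right p q hpq h _ =>
    rintro rfl rfl
    refine .right _ _ (by omega) ?_
    have := hsub 0 1 (by omega) hK1 (by simp) none (by simpa using h)
    simpa using this

/-- Entries beyond the interval are the filler `none`, hence the range conditions on both sides. -/
lemma state_letters {Φ : Formula A} {K : ℕ} {g g' : ℤ → Option A} {x y x' y' : ℤ}
    (h : state Φ K g x y = state Φ K g' x' y') :
    min (y - x).toNat (2 * K + 2) = min (y' - x').toNat (2 * K + 2) ∧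
    (∀ t : ℕ, t < 2 * K + 2 → x + t ≤ y → x' + t ≤ y' → g (x + t) = g' (x' + t)) ∧
    (∀ t : ℕ, t < 2 * K + 2 → x ≤ y - t → x' ≤ y' - t → g (y - t) = g' (y' - t)) := by
  have h0 := congrArg Prod.fst h
  refine ⟨congrArg (fun s => s.1.val) h0, fun t ht h1 h2 => ?_, fun t ht h1 h2 => ?_⟩
  · have := congrFun (congrArg (fun s => s.2.1) h0) ⟨t, ht⟩
    simpa only [state, if_pos h1, if_pos h2] using this
  · have := congrFun (congrArg (fun s => s.2.2) h0) ⟨t, ht⟩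
    simpa only [state, if_pos h1, if_pos h2] using this

/-- Two overlapping subintervals of a long interval determine which atoms can be derived near the
full interval. -/
lemma der_of_state {Φ : Formula A} {K : ℕ} (hK1 : 1 ≤ K) (hK : Φ.Bounded K)
    {g g' : ℤ → Option A} {x y x' y' : ℤ} (hl : 2 * K + 2 < y - x) (hl' : 2 * K + 2 < y' - x')
    (h1 : state Φ K g (x + 1) y = state Φ K g' (x' + 1) y')
    (h2 : state Φ K g x (y - 1) = state Φ K g' x' (y' - 1))
    (hL : leftContext (K + 1) g x = leftContext (K + 1) g' x')
    (hR : rightContext (K + 1) g y = rightContext (K + 1) g' y')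
    (a b : ℕ) (ha : a ≤ K) (hb : b ≤ K) (c) (h : Der Φ g c (x + a) (y - b)) :
    Der Φ g' c (x' + a) (y' - b) := by
  have l1 := (state_letters h2).2.1
  have l2 := (state_letters h1).2.2
  have nx : Near K (x' - x) g g' x := by
    intro t ht1 ht2
    rcases lt_or_ge t x with hlt | hge
    · have := congrFun hL ⟨(x - 1 - t).toNat, by omega⟩
      simp only [leftContext] at this
      rw [show t = x - 1 - ((x - 1 - t).toNat : ℤ) by omega, this]
      congr 1
      omega
    · have := l1 (t - x).toNat (by omega) (by omega) (by omega)
      rw [show t = x + ((t - x).toNat : ℤ) by omega, this]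
      congr 1
      omega
  have ny : Near K (y' - y) g g' y := by
    intro t ht1 ht2
    rcases lt_or_ge y t with hlt | hge
    · have := congrFun hR ⟨(t - y - 1).toNat, by omega⟩
      simp only [rightContext] at this
      rw [show t = y + 1 + ((t - y - 1).toNat : ℤ) by omega, this]
      congr 1
      omega
    · have := l2 (y - t).toNat (by omega) (by omega) (by omega)
      rw [show t = y - ((y - t).toNat : ℤ) by omega, this]
      congr 1
      omega
  have hL' : leftContext (K + 1) g (x + 1) = leftContext (K + 1) g' (x' + 1) := by
    funext t
    have := nx (x + 1 - 1 - t.val) (by omega) (by omega)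
    simp only [leftContext]
    rw [← this]
    congr 1
    omega
  have hR' : rightContext (K + 1) g (y - 1) = rightContext (K + 1) g' (y' - 1) := by
    funext t
    have := ny (y - 1 + 1 + t.val) (by omega) (by omega)
    simp only [rightContext]
    rw [← this]
    congr 1
    omega
  have hsub : ∀ a b : ℕ, a ≤ K → b ≤ K → a ≠ 0 ∨ b ≠ 0 → ∀ c,
      Der Φ g c (x + a) (y - b) → Der Φ g' c (x' + a) (y' - b) := by
    intro a b ha hb hab c h
    -- A proper subinterval lies in `[x, y - 1]` or `[x + 1, y]`, where one offset drops by one.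
    rcases Nat.eq_zero_or_pos a with h0 | h0
    · obtain ⟨b, rfl⟩ : ∃ b', b = b' + 1 := ⟨b - 1, by omega⟩
      have := der_iff_state hK g (x := x) (y := y - 1) (by omega) ⟨a, by omega⟩ ⟨b, by omega⟩ c
      have h' := der_iff_state hK g' (x := x') (y := y' - 1) (by omega) ⟨a, by omega⟩
        ⟨b, by omega⟩ c
      rw [h2, hL, hR', ← h'] at this
      push_cast at h ⊢
      rw [add_comm (b : ℤ), ← sub_sub] at h ⊢
      exact this.1 h
    · obtain ⟨a, rfl⟩ : ∃ a', a = a' + 1 := ⟨a - 1, by omega⟩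
      have := der_iff_state hK g (x := x + 1) (y := y) (by omega) ⟨a, by omega⟩ ⟨b, by omega⟩ c
      have h' := der_iff_state hK g' (x := x' + 1) (y := y') (by omega) ⟨a, by omega⟩
        ⟨b, by omega⟩ c
      rw [h1, hL', hR, ← h'] at this
      push_cast at h ⊢
      rw [add_comm (a : ℤ), ← add_assoc] at h ⊢
      exact this.1 h
  by_cases hab : a ≠ 0 ∨ b ≠ 0
  · exact hsub a b ha hb hab c h
  · obtain ⟨rfl, rfl⟩ : a = 0 ∧ b = 0 := by omega
    simp only [Nat.cast_zero, add_zero, sub_zero] at h ⊢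
    exact h.whole hK1 hK (by omega) (by omega) nx ny hsub

/-- This lets hypotheses on substates survive when arbitrary contexts are glued to the full
interval. -/
lemma state_extend {Φ : Formula A} {K L : ℕ} (hK : Φ.Bounded K) (l r : Fin L → Option A)
    (g : ℤ → Option A) {x y p q : ℤ} (hp : x ≤ p) (hq : q ≤ y) :
    state Φ K (extend l r g x y) p q = state Φ K g p q := by
  have := state_congr hK (D := 0) (g := g) (g' := extend l r g x y) (x := p) (y := q)
    fun t h1 h2 => by rw [add_zero]; exact extend_mid _ _ _ (by omega) (by omega)
  simpa using this

/-- The states of the two maximal proper subintervals determine the state of an interval. -/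
lemma state_determined {Φ : Formula A} {K : ℕ} (hK1 : 1 ≤ K) (hK : Φ.Bounded K)
    {g g' : ℤ → Option A} {x y x' y' : ℤ} (hxy : x < y) (hxy' : x' < y')
    (h1 : state Φ K g (x + 1) y = state Φ K g' (x' + 1) y')
    (h2 : state Φ K g x (y - 1) = state Φ K g' x' (y' - 1)) :
    state Φ K g x y = state Φ K g' x' y' := by
  obtain ⟨k1, l1, r1⟩ := state_letters h1
  obtain ⟨k2, l2, r2⟩ := state_letters h2
  -- Below the cap the two lengths agree, and the `2 * K + 2` recorded letters spell all of `[x + 1,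
  -- y]`; the letter at `x` comes from the other substate.
  by_cases hlen : y - (x + 1) < 2 * K + 2
  · have := state_congr hK (D := x - x') (g := g') (g' := g) (x := x') (y := y') ?_
    · rwa [show x' + (x - x') = x by omega, show y' + (x - x') = y by omega] at this
    · intro t ht1 ht2
      rcases eq_or_lt_of_le ht1 with rfl | hlt
      · have := l2 0 (by omega) (by simp; omega) (by simp; omega)
        simpa using this
      · have := l1 (t - x' - 1).toNat (by omega) (by omega) (by omega)
        rw [show x + 1 + ((t - x' - 1).toNat : ℤ) = t + (x - x') by omega,
          show x' + 1 + ((t - x' - 1).toNat : ℤ) = t by omega] at this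
        exact this
  · have hl : 2 * (K : ℤ) + 2 < y - x := by omega
    have hl' : 2 * (K : ℤ) + 2 < y' - x' := by omega
    refine Prod.ext (Prod.ext ?_ (Prod.ext ?_ ?_)) ?_
    · apply Fin.ext
      simp only [state]
      omega
    · funext t
      simp only [state]
      rw [if_pos (by omega), if_pos (by omega)]
      exact l2 t.val t.isLt (by omega) (by omega)
    · funext t
      simp only [state]
      rw [if_pos (by omega), if_pos (by omega)]
      exact r1 t.val t.isLt (by omega) (by omega)
    · funext l r a b c
      -- Gluing the same `l`, `r` to both intervals makes their contexts equal, as `der_of_state`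
      -- requires.
      have e1 : state Φ K (extend l r g x y) (x + 1) y =
          state Φ K (extend l r g' x' y') (x' + 1) y' := by
        rw [state_extend hK _ _ _ (by omega) le_rfl, state_extend hK _ _ _ (by omega) le_rfl, h1]
      have e2 : state Φ K (extend l r g x y) x (y - 1) =
          state Φ K (extend l r g' x' y') x' (y' - 1) := by
        rw [state_extend hK _ _ _ le_rfl (by omega), state_extend hK _ _ _ le_rfl (by omega), h2]
      have e3 : leftContext (K + 1) (extend l r g x y) x =
          leftContext (K + 1) (extend l r g' x' y') x' := by
        funext t
        simp only [leftContext, extend_left]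
      have e4 : rightContext (K + 1) (extend l r g x y) y =
          rightContext (K + 1) (extend l r g' x' y') y' := by
        funext t
        simp only [rightContext, extend_right _ _ _ hxy.le, extend_right _ _ _ hxy'.le]
      exact propext
        ⟨der_of_state hK1 hK hl hl' e1 e2 e3 e4 a b (by omega) (by omega) c,
         der_of_state hK1 hK hl' hl e1.symm e2.symm e3.symm e4.symm a b (by omega) (by omega) c⟩

/-! ### Words -/

/-- The word `w` as a partial function on `ℤ`. -/
def wordZ (w : List A) : ℤ → Option A
  | Int.ofNat k => w[k]?
  | Int.negSucc _ => none

lemma wordZ_natCast (w : List A) (k : ℕ) : wordZ w (k : ℤ) = w[k]? := rfl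

lemma wordZ_of_neg (w : List A) {t : ℤ} (h : t < 0) : wordZ w t = none := by
  cases t with
  | ofNat k => exact absurd h (by simp)
  | negSucc k => rfl

lemma wordZ_val (w : List A) (i : Fin w.length) : wordZ w (i.val : ℤ) = some (w.get i) := by
  rw [wordZ_natCast]
  simp

lemma wordZ_of_length_le (w : List A) {t : ℤ} (h : (w.length : ℤ) ≤ t) : wordZ w t = none := by
  obtain ⟨k, rfl⟩ := Int.eq_ofNat_of_zero_le (by omega : 0 ≤ t)
  rw [wordZ_natCast]
  simp only [List.getElem?_eq_none_iff]
  omega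

lemma sucZ_wordZ (w : List A) (i : Fin w.length) :
    sucZ (wordZ w) (i.val : ℤ) = ((suc i).val : ℤ) := by
  unfold sucZ suc
  split_ifs with h1 h2 h2
  · simp
  · rw [wordZ_of_length_le w (by omega)] at h1
    simp at h1
  · have := wordZ_val w ⟨i.val + 1, h2⟩
    push_cast at this
    simp [this] at h1
  · rfl

lemma predZ_wordZ (w : List A) (i : Fin w.length) :
    predZ (wordZ w) (i.val : ℤ) = ((pred i).val : ℤ) := by
  unfold predZ
  rw [val_pred]
  rcases Nat.eq_zero_or_pos i.val with h | h
  · rw [wordZ_of_neg w (by omega)]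
    simp [h]
  · have := wordZ_val w ⟨i.val - 1, by omega⟩
    simp only [Nat.cast_sub h, Nat.cast_one] at this
    rw [this]
    simp
    omega

lemma shiftZ_wordZ (w : List A) (a : ℤ) (i : Fin w.length) :
    shiftZ (wordZ w) a (i.val : ℤ) = ((shift a i).val : ℤ) := by
  have hs : ∀ k : ℕ, (sucZ (wordZ w))^[k] (i.val : ℤ) = ((suc^[k] i).val : ℤ) := by
    intro k
    induction k with
    | zero => rfl
    | succ k ih => rw [Function.iterate_succ_apply', Function.iterate_succ_apply', ih, sucZ_wordZ]
  have hp : ∀ k : ℕ, (predZ (wordZ w))^[k] (i.val : ℤ) = ((pred^[k] i).val : ℤ) := by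
    intro k
    induction k with
    | zero => rfl
    | succ k ih => rw [Function.iterate_succ_apply', Function.iterate_succ_apply', ih, predZ_wordZ]
  cases a with
  | ofNat k => exact hs k
  | negSucc k => exact hp (k + 1)

lemma holdsZ_wordZ (w : List A) (U : InputPred A) (i : Fin w.length) :
    U.HoldsZ (wordZ w) (i.val : ℤ) ↔ U.Holds w i := by
  cases U with
  | letter s => simp only [InputPred.HoldsZ, InputPred.Holds, wordZ_val, Option.some.injEq]
  | min =>
    simp only [InputPred.HoldsZ, InputPred.Holds]
    refine ⟨fun h => ?_, fun h => wordZ_of_neg w (by omega)⟩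
    by_contra h0
    have := wordZ_val w ⟨i.val - 1, by omega⟩
    rw [show ((i.val - 1 : ℕ) : ℤ) = (i.val : ℤ) - 1 by omega, h] at this
    simp at this
  | max =>
    simp only [InputPred.HoldsZ, InputPred.Holds]
    refine ⟨fun h => ?_, fun h => wordZ_of_length_le w (by omega)⟩
    by_contra h0
    have := wordZ_val w ⟨i.val + 1, by omega⟩
    rw [show ((i.val + 1 : ℕ) : ℤ) = (i.val : ℤ) + 1 by omega, h] at this
    simp at this

/-! ### Truth in a word and derivability -/

lemma valZ_val {n : ℕ} (x y : Fin n) (v : Var) :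
    v.valZ (x.val : ℤ) (y.val : ℤ) = ((v.val x y).val : ℤ) := by
  cases v <;> rfl

/-- The two conjuncts match the premises `hg` and `hc` of `Der.clause`. -/
lemma holds_iff_guardZ {m : ℕ} (w : List A) (R : Fin m → Fin w.length → Fin w.length → Prop)
    (x y : Fin w.length) (δ : Hyp A m) :
    δ.Holds w R x y ↔ δ.GuardZ (wordZ w) (x.val : ℤ) (y.val : ℤ) ∧
      ∀ S a b, δ = .comp S a b → R S (shift (a : ℤ) x) (shift (-(b : ℤ)) y) := by
  cases δ with
  | posInput U v a => simp [Hyp.Holds, Hyp.GuardZ, valZ_val, shiftZ_wordZ, holdsZ_wordZ]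
  | negInput U v a => simp [Hyp.Holds, Hyp.GuardZ, valZ_val, shiftZ_wordZ, holdsZ_wordZ]
  | eq => simp [Hyp.Holds, Hyp.GuardZ, Fin.ext_iff]
  | lt => simp [Hyp.Holds, Hyp.GuardZ]
  | comp S a b =>
    simp only [Hyp.Holds, Hyp.GuardZ, shiftZ_wordZ, Fin.le_def, Nat.cast_le]
    constructor
    · rintro ⟨h1, h2⟩
      refine ⟨h2, ?_⟩
      rintro S a b h
      injection h with e1 e2 e3
      subst e1 e2 e3
      exact h1
    · rintro ⟨h1, h2⟩
      exact ⟨h2 S a b rfl, h1⟩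

/-- A formula holds in a word iff no contradiction is derivable on the whole word. -/
lemma models_iff_not_der (Φ : Formula A) (w : List A) (hw : w ≠ []) :
    Φ.Models w ↔ ¬ Der Φ (wordZ w) none 0 ((w.length - 1 : ℕ) : ℤ) := by
  have hpos := List.length_pos_iff.2 hw
  constructor
  · rintro ⟨R, hR⟩ hder
    -- Every model contains all derivable atoms, and `none` would give `False` at any position.
    have key : ∀ c p q, Der Φ (wordZ w) c p q → ∀ x y : Fin w.length, p = x.val → q = y.val →
        c.elim False fun S => R S x y := by
      intro c p q h
      induction h with
      | clause C hC p q hpq hg hc ih =>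
        rintro x y rfl rfl
        have hC' := hR x y C hC (Fin.le_def.2 (by omega)) fun δ hδ => ?_
        · revert hC'
          cases C.concl <;> exact id
        rw [holds_iff_guardZ]
        refine ⟨hg δ hδ, ?_⟩
        rintro S a b rfl
        exact ih S a b hδ _ _ (shiftZ_wordZ w _ x) (shiftZ_wordZ w _ y)
      | left p q hpq h ih =>
        rintro x y rfl rfl
        exact ih ⟨x.val + 1, by omega⟩ y (by simp) rfl
      | right p q hpq h ih =>
        rintro x y rfl rfl
        exact ih x ⟨y.val - 1, by omega⟩ rfl (by simp; omega)
    exact key none _ _ hder ⟨0, hpos⟩ ⟨w.length - 1, by omega⟩ rfl rfl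
  · intro hder
    -- The least model: the derivable atoms.
    refine ⟨fun S x y => Der Φ (wordZ w) (some S) x.val y.val, fun x y C hC hxy hyp => ?_⟩
    have hd : Der Φ (wordZ w) C.concl x.val y.val := by
      refine .clause C hC _ _ (by simpa using hxy) (fun δ hδ => ?_) fun S a b hδ => ?_
      · exact ((holds_iff_guardZ w _ x y δ).1 (hyp δ hδ)).1
      · rw [shiftZ_wordZ, shiftZ_wordZ]
        exact ((holds_iff_guardZ w _ x y _).1 (hyp _ hδ)).2 S a b rfl
    revert hd
    cases C.concl with
    | some S => exact id
    | none =>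
      intro hd
      apply hder
      -- A contradiction at `(x, y)` is spread to the left end, then to the right end.
      have hL : ∀ (k : ℕ) (p q : ℤ), p ≤ q → Der Φ (wordZ w) none p q →
          Der Φ (wordZ w) none (p - k) q := by
        intro k
        induction k with
        | zero => intro p q _ h; simpa using h
        | succ k ih =>
          intro p q hpq h
          refine .left _ _ (by push_cast; omega) ?_
          have := ih p q hpq h
          rwa [show p - ((k + 1 : ℕ) : ℤ) + 1 = p - k by push_cast; ring]
      have hR : ∀ (k : ℕ) (p q : ℤ), p ≤ q → Der Φ (wordZ w) none p q →
          Der Φ (wordZ w) none p (q + k) := by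
        intro k
        induction k with
        | zero => intro p q _ h; simpa using h
        | succ k ih =>
          intro p q hpq h
          refine .right _ _ (by push_cast; omega) ?_
          have := ih p q hpq h
          rwa [show q + ((k + 1 : ℕ) : ℤ) - 1 = q + k by push_cast; ring]
      have h1 := hL x.val _ _ hd.le hd
      have h2 := hR (w.length - 1 - y.val) _ _ h1.le h1
      rwa [sub_self, show (y.val : ℤ) + ((w.length - 1 - y.val : ℕ) : ℤ) =
        ((w.length - 1 : ℕ) : ℤ) by omega] at h2

/-! ### Assembly of the automaton -/

theorem exists_normalized_equivalent [Finite A] (Φ : Formula A) :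
    ∃ Φ' : Formula A, Φ'.IsNormalized ∧ Φ.Equivalent Φ' := by
  classical
  obtain ⟨K, hK1, hK⟩ := Φ.exists_bounded
  -- Only the letter at `0` matters, so any word with `s` there would do.
  let init : A → State A Φ.numPreds K := fun s => state Φ K (fun _ => some s) 0 0
  let P : State A Φ.numPreds K → State A Φ.numPreds K → (ℤ → Option A) × ℤ × ℤ → Prop :=
    fun p q z => z.2.1 < z.2.2 ∧ state Φ K z.1 (z.2.1 + 1) z.2.2 = p ∧
      state Φ K z.1 z.2.1 (z.2.2 - 1) = q
  -- By `state_determined` any representative gives the same value; the default `p` covers pairs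
  -- that no interval realizes.
  let f : State A Φ.numPreds K → State A Φ.numPreds K → State A Φ.numPreds K := fun p q =>
    if h : ∃ z, P p q z then state Φ K h.choose.1 h.choose.2.1 h.choose.2.2 else p
  have hf : ∀ g x y, x < y →
      state Φ K g x y = f (state Φ K g (x + 1) y) (state Φ K g x (y - 1)) := by
    intro g x y hxy
    have hex : ∃ z, P (state Φ K g (x + 1) y) (state Φ K g x (y - 1)) z :=
      ⟨(g, x, y), hxy, rfl, rfl⟩
    obtain ⟨h1, h2, h3⟩ := hex.choose_spec
    simp only [f, dif_pos hex]
    exact state_determined hK1 hK hxy h1 h2.symm h3.symm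
  -- Blank contexts, because the cells outside the whole word are blank.
  let rej : State A Φ.numPreds K → Prop := fun q => q.2 (fun _ => none) (fun _ => none) 0 0 none
  obtain ⟨Φ', hn, hΦ'⟩ := exists_normalized_of_trellis init f rej
  refine ⟨Φ', hn, fun w hw => ?_⟩
  have hpos := List.length_pos_iff.2 hw
  rw [hΦ' w hw (fun x y => state Φ K (wordZ w) x.val y.val), models_iff_not_der Φ w hw]
  · have := der_iff_state hK (wordZ w) (x := 0) (y := ((w.length - 1 : ℕ) : ℤ)) (by omega) 0 0 none
    have e1 : leftContext (K + 1) (wordZ w) 0 = fun _ => none :=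
      funext fun t => wordZ_of_neg w (by omega)
    have e2 : rightContext (K + 1) (wordZ w) ((w.length - 1 : ℕ) : ℤ) = fun _ => none :=
      funext fun t => wordZ_of_length_le w (by omega)
    rw [e1, e2] at this
    simpa [rej] using not_congr this
  · intro x
    have := state_congr hK (D := (x.val : ℤ)) (g := fun _ => some (w.get x)) (g' := wordZ w)
      (x := 0) (y := 0) fun t h1 h2 => by
        obtain rfl : t = 0 := by omega
        rw [zero_add, wordZ_val]
    simpa only [zero_add] using this
  · intro x y hxy
    have h1 := val_suc hxy
    have h2 := val_pred y
    rw [Fin.lt_def] at hxy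
    rw [hf _ _ _ (by omega), show ((x.val : ℤ) + 1) = ((suc x).val : ℤ) by omega,
      show ((y.val : ℤ) - 1) = ((pred y).val : ℤ) by omega]

end InclLogic

theorem mainTheorem6 {A : Type*} [Finite A] (Φ : InclLogic.Formula A) :
    ∃ Φ' : InclLogic.Formula A, Φ'.IsNormalized ∧ Φ.Equivalent Φ' :=
  InclLogic.exists_normalized_equivalent Φ
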